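/- Let $N \ge 1$ be an integer, $1 \le p < \infty$ and $1 \le q < \infty$. For a (Lebesgue) measurable function $f : \mathbb{R}^N\times\mathbb{R}^N \to \mathbb{R}$ set $$\|f\|_{L^{p,q}(\mathbb{R}^N\times\mathbb{R}^N)} := \Bigl( p\int_0^\infty \lambda^q\, \mathcal{L}^{2N}\bigl(\{(x,y)\in\mathbb{R}^N\times\mathbb{R}^N : |f(x,y)|\ge\lambda\}\bigr)^{q/p}\,\frac{d\lambda}{\lambda}\Bigr)^{1/q} \in [0,\infty],$$ where $\mathcal{L}^{2N}$ is Lebesgue measure on $\mathbb{R}^N\times\mathbb{R}^N$ and $|\cdot|$ is the Euclidean norm on $\mathbb{R}^N$. Then the following hold. (i) If $u:\mathbb{R}^N\to\mathbb{R}$ is (Lebesgue) measurable and $$\Bigl\| \frac{u(x)-u(y)}{|x-y|^{N/p+1}} \Bigr\|_{L^{p,q}(\mathbb{R}^N\times\mathbb{R}^N)} < \infty,$$ then $u$ is constant, that is, there is $c\in\mathbb{R}$ with $u(x)=c$ for almost every $x\in\mathbb{R}^N$. (ii) Consequently, there is no finite constant $C = C(N,p,q)$ such that $$\Bigl\| \frac{u(x)-u(y)}{|x-y|^{N/p+1}}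 \Bigr\|_{L^{p,q}(\mathbb{R}^N\times\mathbb{R}^N)} \le C\,\|\nabla u\|_{L^p(\mathbb{R}^N)} \qquad \text{for all } u\in C_c^\infty(\mathbb{R}^N).$$ -/

import Mathlib

open MeasureTheory Filter
open scoped NNReal ENNReal

noncomputable section

/-- The Lorentz quasinorm of a real function `f` for finite exponents `p`, `q`,
`(p ∫₀^∞ t ^ q μ{|f| ≥ t} ^ (q / p) dt / t) ^ (1 / q)`, with values in `[0, ∞]`. -/
def lorentzQuasinorm {α : Type*} [MeasurableSpace α] (f : α → ℝ) (p q : ℝ)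
    (μ : Measure α) : ℝ≥0∞ :=
  (ENNReal.ofReal p * ∫⁻ t in Set.Ioi (0 : ℝ),
    ENNReal.ofReal t ^ q * μ {z | t ≤ |f z|} ^ (q / p) / ENNReal.ofReal t) ^ (1 / q)

/-- The difference quotient `(u x - u y) / |x - y| ^ (N / p + 1)` on `ℝ^N × ℝ^N`. -/
def diffQuotient {N : ℕ} (p : ℝ) (u : EuclideanSpace ℝ (Fin N) → ℝ)
    (z : EuclideanSpace ℝ (Fin N) × EuclideanSpace ℝ (Fin N)) : ℝ :=
  (u z.1 - u z.2) / ‖z.1 - z.2‖ ^ ((N : ℝ) / p + 1)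

end

open Set Metric Topology

/-! Composing `u` with `arctan` makes it bounded, shrinks its differences and loses no information.
Since `q` is finite, the dyadic quantities `a k = 2^((k+1)p) |{|F| ≥ 2^(k+1)}|` of the resulting
quotient `F` tend to zero. Splitting an increment `h` into `2^j` equal steps shows that `∫ |F|^p`
over the shell `|x - y| ~ ρ / 2^j` is at least a fixed multiple `c` of the integral of `|v(h+y) -
v(y)|^p` over `|h| ~ ρ`, for every `j` (`setLIntegral_dyadicShell_le`). Thus `J` shells carry at
least `J c`. Boundedness gives `|F| ≤ 2^(O(J))` there, so the layer-cake bound is `O(1 + ∑ a k)`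
over `O(J)` levels, which is `o(J)` by Cesàro. Hence `c = 0` (`eq_zero_of_le_setLIntegral_rpow`) and
increments vanish almost everywhere. A bump function then refutes the inequality. -/

/-! ### Dyadic layer cake and Cesàro averaging -/

/-- The highest dyadic level reached by `x` alone dominates `x ^ p`; the constant `2 ^ p` covers `x
≤ 2`. -/
theorem ENNReal.rpow_le_add_sum_dyadic {p : ℝ} (hp : 0 ≤ p) (K : ℕ) (x : ℝ≥0∞)
    (hx : x ≤ 2 ^ (K + 1)) :
    x ^ p ≤ 2 ^ p + ∑ k ∈ Finset.range K,
      2 ^ p * ((2 ^ (k + 1)) ^ p * {y : ℝ≥0∞ | 2 ^ (k + 1) ≤ y}.indicator 1 x) := by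
  induction K with
  | zero => simpa using ENNReal.rpow_le_rpow hx hp
  | succ K ih =>
    rw [Finset.sum_range_succ]
    rcases le_total x (2 ^ (K + 1)) with h | h
    · rw [← add_assoc]
      exact (ih h).trans le_self_add
    · have h1 : {y : ℝ≥0∞ | 2 ^ (K + 1) ≤ y}.indicator (1 : ℝ≥0∞ → ℝ≥0∞) x = 1 := by
        simp [h]
      rw [h1, mul_one, ← ENNReal.mul_rpow_of_nonneg _ _ hp, ← pow_succ', ← add_assoc]
      exact (ENNReal.rpow_le_rpow hx hp).trans le_add_self

/-- If the dyadic weak `L^p` quantities of `G` tend to zero and `G` grows at most geometrically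
along disjoint sets `S j`, then the integrals of `G ^ p` over the `S j` have no positive
lower bound. -/
theorem MeasureTheory.eq_zero_of_le_setLIntegral_rpow {X : Type*} [MeasurableSpace X]
    {ν : Measure X}
    {G : X → ℝ≥0∞} (hG : Measurable G) {p : ℝ} (hp : 0 ≤ p) {S : ℕ → Set X}
    (hS : ∀ j, MeasurableSet (S j)) (hd : Pairwise (Function.onFun Disjoint S))
    (hfin : ν (⋃ j, S j) ≠ ∞) {m K₀ : ℕ} (hm : 1 ≤ m)
    (hb : ∀ j, ∀ z ∈ S j, G z ≤ 2 ^ (m * j + K₀ + 1))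
    (ha : Tendsto (fun k : ℕ => (2 ^ (k + 1)) ^ p * ν {z | 2 ^ (k + 1) ≤ G z}) atTop (𝓝 0))
    (ha' : ∀ k : ℕ, (2 ^ (k + 1)) ^ p * ν {z | 2 ^ (k + 1) ≤ G z} ≠ ∞)
    {c : ℝ≥0∞} (hc : ∀ j, c ≤ ∫⁻ z in S j, G z ^ p ∂ν) : c = 0 := by
  set a : ℕ → ℝ≥0∞ := fun k => (2 ^ (k + 1)) ^ p * ν {z | 2 ^ (k + 1) ≤ G z}
  have h2 : (2 : ℝ≥0∞) ^ p ≠ ∞ := ENNReal.rpow_ne_top_of_nonneg hp (by simp)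
  have key : ∀ J : ℕ, J * c ≤ 2 ^ p * ν (⋃ j, S j) +
      2 ^ p * ∑ k ∈ Finset.range (m * J + K₀), a k := by
    intro J
    set T := ⋃ j ∈ Finset.range J, S j with hT
    have hTm : MeasurableSet T := Finset.measurableSet_biUnion _ fun j _ => hS j
    have hTS : T ⊆ ⋃ j, S j := by
      intro z hz
      simp only [hT, mem_iUnion] at hz ⊢
      obtain ⟨j, _, h⟩ := hz
      exact ⟨j, h⟩
    calc (J : ℝ≥0∞) * c = ∑ j ∈ Finset.range J, c := by simp
      _ ≤ ∑ j ∈ Finset.range J, ∫⁻ z in S j, G z ^ p ∂ν := Finset.sum_le_sum fun j _ => hc j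
      _ = ∫⁻ z in T, G z ^ p ∂ν := by
        rw [hT, lintegral_biUnion_finset (fun i _ j _ h => hd h) (fun j _ => hS j)]
      _ ≤ ∫⁻ z in T, (2 ^ p + ∑ k ∈ Finset.range (m * J + K₀),
          2 ^ p * ((2 ^ (k + 1)) ^ p * {z | 2 ^ (k + 1) ≤ G z}.indicator 1 z)) ∂ν := by
        refine setLIntegral_mono' hTm fun z hz => ?_
        refine ENNReal.rpow_le_add_sum_dyadic hp _ _ ?_
        simp only [hT, mem_iUnion, Finset.mem_range] at hz
        obtain ⟨j, hj, h⟩ := hz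
        refine (hb j z h).trans (pow_le_pow_right₀ (by norm_num) ?_)
        gcongr
      _ ≤ 2 ^ p * ν (⋃ j, S j) + 2 ^ p * ∑ k ∈ Finset.range (m * J + K₀), a k := by
        have hms : ∀ k : ℕ, MeasurableSet {z | 2 ^ (k + 1) ≤ G z} := fun k =>
          measurableSet_le measurable_const hG
        rw [lintegral_add_left measurable_const, lintegral_finsetSum, Finset.mul_sum]
        · gcongr with k
          · simp only [lintegral_const, Measure.restrict_apply_univ]
            gcongr
          · rw [lintegral_const_mul, lintegral_const_mul, lintegral_indicator_one (hms k)]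
            · exact mul_le_mul_right (mul_le_mul_right (Measure.restrict_apply_le _ _) _) _
            · exact measurable_one.indicator (hms k)
            · exact (measurable_one.indicator (hms k)).const_mul _
        · intro k _
          exact ((measurable_one.indicator (hms k)).const_mul _).const_mul _
  have hsum : ∀ n : ℕ, ∑ k ∈ Finset.range n, a k ≠ ∞ := fun n =>
    ENNReal.sum_ne_top.2 fun k _ => ha' k
  have hU : 2 ^ p * ν (⋃ j, S j) ≠ ∞ := ENNReal.mul_ne_top h2 hfin
  have hct : c ≠ ∞ := by
    refine ne_top_of_le_ne_top
      (ENNReal.add_ne_top.2 ⟨hU, ENNReal.mul_ne_top h2 (hsum (m * 1 + K₀))⟩) ?_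
    simpa using key 1
  have hb0 : Tendsto (fun k => (a k).toReal) atTop (𝓝 0) :=
    (ENNReal.tendsto_toReal ENNReal.zero_ne_top).comp ha
  have hn : Tendsto (fun J : ℕ => m * J + K₀) atTop atTop :=
    tendsto_atTop_mono (fun J => show J ≤ m * J + K₀ by nlinarith) tendsto_id
  have hces := hb0.cesaro.comp hn
  set C := (2 ^ p * ν (⋃ j, S j)).toReal
  set D := ((2 : ℝ≥0∞) ^ p).toReal
  -- The factor `m + K₀` comes from `m J + K₀ ≤ (m + K₀) J`: dividing by `J` costs only a constant
  -- against the Cesàro mean.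
  have hlim : Tendsto (fun J : ℕ => C / J + D * (m + K₀) *
      (((m * J + K₀ : ℕ) : ℝ)⁻¹ * ∑ k ∈ Finset.range (m * J + K₀), (a k).toReal)) atTop
      (𝓝 0) := by
    have := (tendsto_const_div_atTop_nhds_zero_nat C).add (hces.const_mul (D * (m + K₀)))
    simpa using this
  have hle : c.toReal ≤ 0 := by
    refine ge_of_tendsto hlim (eventually_atTop.2 ⟨1, fun J hJ => ?_⟩)
    have hk := ENNReal.toReal_mono
      (ENNReal.add_ne_top.2 ⟨hU, ENNReal.mul_ne_top h2 (hsum _)⟩) (key J)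
    rw [ENNReal.toReal_add hU (ENNReal.mul_ne_top h2 (hsum _)),
      ENNReal.toReal_mul (a := (J : ℝ≥0∞)), ENNReal.toReal_natCast,
      ENNReal.toReal_mul (b := ∑ k ∈ _, _), ENNReal.toReal_sum (fun k _ => ha' k)] at hk
    set s := ∑ k ∈ Finset.range (m * J + K₀), (a k).toReal
    have hs : 0 ≤ s := Finset.sum_nonneg fun _ _ => ENNReal.toReal_nonneg
    have hD : 0 ≤ D := ENNReal.toReal_nonneg
    have hJ' : (1 : ℝ) ≤ J := by exact_mod_cast hJ
    have hm' : (1 : ℝ) ≤ m := by exact_mod_cast hm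
    have hK : (0 : ℝ) ≤ K₀ := K₀.cast_nonneg
    have hn0 : (0 : ℝ) < m * J + K₀ := by positivity
    have h1 : 1 / (J : ℝ) ≤ (m + K₀) / (m * J + K₀) := by
      rw [div_le_div_iff₀ (by positivity) hn0]
      nlinarith
    calc c.toReal = (J * c.toReal) / J := by field_simp
      _ ≤ (C + D * s) / J := by gcongr
      _ = C / J + D * s * (1 / J) := by ring
      _ ≤ C / J + D * s * ((m + K₀) / (m * J + K₀)) := by gcongr
      _ = _ := by push_cast; ring
  have := le_antisymm hle ENNReal.toReal_nonneg
  exact ((ENNReal.toReal_eq_zero_iff c).1 this).resolve_right hct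

/-! ### Telescoping increments and rescaling -/

theorem enorm_sub_rpow_le_sum {E : Type*} [AddCommGroup E] (v : E → ℝ) {p : ℝ} (hp : 1 ≤ p)
    (n : ℕ) (w y : E) :
    ‖v (n • w + y) - v y‖ₑ ^ p ≤
      (n : ℝ≥0∞) ^ (p - 1) * ∑ i ∈ Finset.range n, ‖v (w + (i • w + y)) - v (i • w + y)‖ₑ ^ p := by
  have h : v (n • w + y) - v y =
      ∑ i ∈ Finset.range n, (v (w + (i • w + y)) - v (i • w + y)) := by
    have := Finset.sum_range_sub (fun i : ℕ => v (i • w + y)) n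
    simp only [zero_smul, zero_add] at this
    rw [← this]
    refine Finset.sum_congr rfl fun i _ => ?_
    rw [succ_nsmul', add_assoc]
  rw [h]
  refine (ENNReal.rpow_le_rpow (enorm_sum_le _ _) (by linarith)).trans ?_
  simpa using ENNReal.rpow_sum_le_const_mul_sum_rpow (Finset.range n)
    (fun i => ‖v (w + (i • w + y)) - v (i • w + y)‖ₑ) hp

/-- The power-mean inequality costs `n ^ (p - 1)`, and the `n` translated integrals each fit in the
enlarged ball, whence `n ^ p`. -/
theorem setLIntegral_ball_enorm_sub_rpow_le {E : Type*} [NormedAddCommGroup E] [NormedSpace ℝ E]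
    [MeasurableSpace E] [BorelSpace E] [SecondCountableTopology E] {μ : Measure E}
    [μ.IsAddLeftInvariant] {v : E → ℝ}
    (hv : Measurable v) {p : ℝ} (hp : 1 ≤ p) (n : ℕ) (w : E) (r : ℝ) :
    ∫⁻ y in ball 0 r, ‖v (n • w + y) - v y‖ₑ ^ p ∂μ ≤
      (n : ℝ≥0∞) ^ p * ∫⁻ y in ball 0 (r + n * ‖w‖), ‖v (w + y) - v y‖ₑ ^ p ∂μ := by
  set f : E → ℝ≥0∞ := fun y => ‖v (w + y) - v y‖ₑ ^ p with hf
  have hfm : Measurable f := by fun_prop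
  calc ∫⁻ y in ball 0 r, ‖v (n • w + y) - v y‖ₑ ^ p ∂μ
      ≤ ∫⁻ y in ball 0 r, (n : ℝ≥0∞) ^ (p - 1) * ∑ i ∈ Finset.range n, f (i • w + y) ∂μ :=
        lintegral_mono fun y => enorm_sub_rpow_le_sum v hp n w y
    _ = (n : ℝ≥0∞) ^ (p - 1) * ∑ i ∈ Finset.range n, ∫⁻ y in ball 0 r, f (i • w + y) ∂μ := by
        rw [lintegral_const_mul _ (by fun_prop), lintegral_finsetSum _ (by fun_prop)]
    _ ≤ (n : ℝ≥0∞) ^ (p - 1) * ∑ i ∈ Finset.range n, ∫⁻ y in ball 0 (r + n * ‖w‖), f y ∂μ := by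
        refine mul_le_mul_right (Finset.sum_le_sum fun i hi => ?_) _
        rw [← lintegral_indicator measurableSet_ball, ← lintegral_indicator measurableSet_ball,
          ← lintegral_add_left_eq_self ((ball 0 (r + n * ‖w‖)).indicator f) (i • w)]
        refine lintegral_mono fun y => ?_
        by_cases hy : y ∈ ball (0 : E) r
        · have hy' : i • w + y ∈ ball (0 : E) (r + n * ‖w‖) := by
            rw [mem_ball_zero_iff] at hy ⊢
            have h1 : ‖i • w‖ ≤ n * ‖w‖ := by
              refine (norm_nsmul_le (n := i) (a := w)).trans ?_
              have : (i : ℝ) ≤ n := by exact_mod_cast (Finset.mem_range.1 hi).le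
              gcongr
            linarith [norm_add_le (i • w) y]
          simp only [indicator_of_mem hy, indicator_of_mem hy', le_refl]
        · simp [indicator_of_notMem hy]
    _ = (n : ℝ≥0∞) ^ p * ∫⁻ y in ball 0 (r + n * ‖w‖), f y ∂μ := by
        rcases Nat.eq_zero_or_pos n with rfl | hn
        · simp [ENNReal.zero_rpow_of_pos (by linarith : 0 < p)]
        · rw [Finset.sum_const, Finset.card_range, nsmul_eq_mul, ← mul_assoc]
          congr 1
          have hn0 : (n : ℝ≥0∞) ≠ 0 := by exact_mod_cast hn.ne'
          nth_rw 2 [← ENNReal.rpow_one (n : ℝ≥0∞)]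
          rw [← ENNReal.rpow_add _ _ hn0 (by simp)]
          congr 1; ring

open Module in
theorem lintegral_comp_nsmul {E : Type*} [NormedAddCommGroup E] [NormedSpace ℝ E]
    [MeasurableSpace E] [BorelSpace E] [FiniteDimensional ℝ E] (μ : Measure E)
    [μ.IsAddHaarMeasure] (f : E → ℝ≥0∞) {n : ℕ} (hn : n ≠ 0) :
    ∫⁻ x, f x ∂μ = (n : ℝ≥0∞) ^ finrank ℝ E * ∫⁻ x, f (n • x) ∂μ := by
  have hn' : (n : ℝ) ≠ 0 := by exact_mod_cast hn
  have h := lintegral_map_equiv (μ := μ) f (Homeomorph.smulOfNeZero (n : ℝ) hn').toMeasurableEquiv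
  have h2 : ∀ x : E, (Homeomorph.smulOfNeZero (n : ℝ) hn').toMeasurableEquiv x = n • x := by
    intro x; simp [← Nat.cast_smul_eq_nsmul ℝ]
  simp only [h2] at h
  have h3 : Measure.map (⇑(Homeomorph.smulOfNeZero (n : ℝ) hn').toMeasurableEquiv) μ =
      ENNReal.ofReal |((n : ℝ) ^ finrank ℝ E)⁻¹| • μ := Measure.map_addHaar_smul μ hn'
  rw [h3, lintegral_smul_measure] at h
  rw [← h, abs_of_nonneg (by positivity), ENNReal.ofReal_inv_of_pos (by positivity),
    ENNReal.ofReal_pow (by positivity), ENNReal.ofReal_natCast, smul_eq_mul, ← mul_assoc,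
    ENNReal.mul_inv_cancel, one_mul]
  · simp [hn]
  · simp

/-! ### Dyadic shells -/

/-- The half-open shell `ρ / 2 < ‖h‖ ≤ ρ`. -/
def dyadicShell (E : Type*) [Norm E] (ρ : ℝ) : Set E := {h | ρ / 2 < ‖h‖ ∧ ‖h‖ ≤ ρ}

theorem measurableSet_dyadicShell {E : Type*} [NormedAddCommGroup E] [MeasurableSpace E]
    [BorelSpace E] (ρ : ℝ) : MeasurableSet (dyadicShell E ρ) :=
  (measurableSet_lt measurable_const measurable_norm).inter
    (measurableSet_le measurable_norm measurable_const)

theorem measurable_diffQuotient {N : ℕ} {p : ℝ} {v : EuclideanSpace ℝ (Fin N) → ℝ}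
    (hv : Measurable v) : Measurable (diffQuotient p v) := by
  unfold diffQuotient
  fun_prop

theorem enorm_diffQuotient_rpow {N : ℕ} {p : ℝ} (hp : 1 ≤ p) (v : EuclideanSpace ℝ (Fin N) → ℝ)
    (w y : EuclideanSpace ℝ (Fin N)) :
    ‖diffQuotient p v (w + y, y)‖ₑ ^ p =
      ENNReal.ofReal (|v (w + y) - v y| ^ p / ‖w‖ ^ ((N : ℝ) + p)) := by
  have hp0 : 0 < p := by linarith
  rw [← ofReal_norm, Real.norm_eq_abs, ENNReal.ofReal_rpow_of_nonneg (abs_nonneg _) hp0.le]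
  simp only [diffQuotient, add_sub_cancel_right]
  rw [abs_div, abs_of_nonneg (Real.rpow_nonneg (norm_nonneg w) _),
    Real.div_rpow (abs_nonneg _) (Real.rpow_nonneg (norm_nonneg _) _),
    ← Real.rpow_mul (norm_nonneg w)]
  congr 3
  field_simp

/-- The substitution `h = n w` yields `n ^ N` and telescoping yields `n ^ p`; since `n ‖w‖ ≤ ρ`,
together they are absorbed by the weight `‖w‖ ^ (N + p)`. The constant is therefore independent of
`n`. -/
theorem setLIntegral_dyadicShell_le {N : ℕ} {p : ℝ} (hp : 1 ≤ p)
    {v : EuclideanSpace ℝ (Fin N) → ℝ} (hv : Measurable v) {n : ℕ} (hn : n ≠ 0) {ρ : ℝ}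
    (hρ : 0 < ρ) (r : ℝ) :
    ∫⁻ h in dyadicShell _ ρ, ∫⁻ y in ball 0 r, ‖v (h + y) - v y‖ₑ ^ p ≤
      ENNReal.ofReal (ρ ^ ((N : ℝ) + p)) *
        ∫⁻ w in dyadicShell _ (ρ / n), ∫⁻ y in ball 0 (r + ρ),
          ‖diffQuotient p v (w + y, y)‖ₑ ^ p := by
  have hp0 : 0 < p := by linarith
  have hn0 : (0 : ℝ) < n := by positivity
  have hmem : ∀ w : EuclideanSpace ℝ (Fin N),
      n • w ∈ dyadicShell _ ρ ↔ w ∈ dyadicShell (EuclideanSpace ℝ (Fin N)) (ρ / n) := by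
    intro w
    have h : ‖n • w‖ = n * ‖w‖ := by rw [← Nat.cast_smul_eq_nsmul ℝ, norm_smul]; simp
    simp only [dyadicShell, mem_ofPred_eq, h]
    rw [le_div_iff₀ hn0, div_right_comm, div_lt_iff₀ hn0, mul_comm ‖w‖]
  have htop : (n : ℝ≥0∞) ^ p ≠ ∞ := ENNReal.rpow_ne_top_of_nonneg hp0.le (by simp)
  rw [← lintegral_indicator (measurableSet_dyadicShell _), lintegral_comp_nsmul _ _ hn,
    finrank_euclideanSpace_fin, ← lintegral_const_mul' _ _ (by simp),
    ← lintegral_const_mul' _ _ ENNReal.ofReal_ne_top,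
    ← lintegral_indicator (measurableSet_dyadicShell _)]
  refine lintegral_mono fun w => ?_
  by_cases hw : w ∈ dyadicShell (EuclideanSpace ℝ (Fin N)) (ρ / n)
  · simp only [indicator_of_mem ((hmem w).2 hw), indicator_of_mem hw]
    have hw0 : 0 < ‖w‖ := lt_of_le_of_lt (by positivity) hw.1
    have hwρ : n * ‖w‖ ≤ ρ := by rw [mul_comm, ← le_div_iff₀ hn0]; exact hw.2
    refine (mul_le_mul_right (setLIntegral_ball_enorm_sub_rpow_le hv hp n w r) _).trans ?_
    refine (mul_le_mul_right (mul_le_mul_right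
      (lintegral_mono_set (ball_subset_ball (add_le_add_right hwρ r))) _) _).trans ?_
    rw [← lintegral_const_mul' _ _ htop, ← lintegral_const_mul' _ _ (by simp),
      ← lintegral_const_mul' _ _ ENNReal.ofReal_ne_top]
    refine lintegral_mono fun y => ?_
    simp only [enorm_diffQuotient_rpow hp]
    rw [← ofReal_norm, Real.norm_eq_abs, ENNReal.ofReal_rpow_of_nonneg (abs_nonneg _) hp0.le,
      ← ENNReal.ofReal_natCast n, ENNReal.ofReal_rpow_of_nonneg hn0.le hp0.le,
      ← ENNReal.ofReal_pow hn0.le, ← ENNReal.ofReal_mul (by positivity),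
      ← ENNReal.ofReal_mul (by positivity), ← ENNReal.ofReal_mul (by positivity),
      ← Real.rpow_natCast, ← mul_assoc, ← Real.rpow_add hn0]
    refine ENNReal.ofReal_le_ofReal ?_
    rw [← mul_div_assoc, le_div_iff₀ (by positivity)]
    calc (n : ℝ) ^ ((N : ℝ) + p) * |v (w + y) - v y| ^ p * ‖w‖ ^ ((N : ℝ) + p)
        = (n * ‖w‖) ^ ((N : ℝ) + p) * |v (w + y) - v y| ^ p := by
          rw [Real.mul_rpow hn0.le hw0.le]; ring
      _ ≤ ρ ^ ((N : ℝ) + p) * |v (w + y) - v y| ^ p := by gcongr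
  · simp [indicator_of_notMem hw, indicator_of_notMem (fun h => hw ((hmem w).1 h))]

theorem pairwise_disjoint_dyadicShell (E : Type*) [Norm E] {ρ : ℝ} (hρ : 0 < ρ) :
    Pairwise (Function.onFun Disjoint fun j : ℕ => dyadicShell E (ρ / (2 ^ j : ℕ))) := by
  refine (pairwise_disjoint_on _).2 fun i j hij => ?_
  refine Set.disjoint_left.2 fun h hi hj => ?_
  have h1 : ρ / (2 ^ j : ℕ) ≤ ρ / (2 ^ i : ℕ) / 2 := by
    rw [div_div]
    push_cast
    rw [← pow_succ]
    gcongr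
    · norm_num
    · exact hij
  exact absurd (hj.2.trans h1) (not_le.2 hi.1)

theorem exists_enorm_diffQuotient_le_two_pow {N : ℕ} {p : ℝ} (hp : 1 ≤ p)
    {v : EuclideanSpace ℝ (Fin N) → ℝ} {M : ℝ} (hM : ∀ x y, |v x - v y| ≤ M) {ρ : ℝ}
    (hρ : 0 < ρ) :
    ∃ m K₀ : ℕ, 1 ≤ m ∧ ∀ j : ℕ, ∀ w ∈ dyadicShell _ (ρ / (2 ^ j : ℕ)), ∀ y,
      ‖diffQuotient p v (w + y, y)‖ₑ ≤ 2 ^ (m * j + K₀ + 1) := by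
  set γ : ℝ := (N : ℝ) / p + 1 with hγ
  have hγ0 : 0 ≤ γ := by positivity
  have hM0 : 0 ≤ M := (abs_nonneg _).trans (hM 0 0)
  obtain ⟨m, hm⟩ := exists_nat_ge γ
  obtain ⟨K₀, hK⟩ := pow_unbounded_of_one_lt (M * (2 / ρ) ^ γ) (one_lt_two : (1 : ℝ) < 2)
  refine ⟨m + 1, K₀, by omega, fun j w hw y => ?_⟩
  have hpos : 0 < ρ / (2 ^ j : ℕ) / 2 := by positivity
  have hw0 : 0 < ‖w‖ := hpos.trans hw.1
  have hj : ((2 : ℝ) ^ j) ^ γ ≤ 2 ^ ((m + 1) * j) := by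
    calc ((2 : ℝ) ^ j) ^ γ ≤ ((2 : ℝ) ^ j) ^ ((m + 1 : ℕ) : ℝ) := by
          refine Real.rpow_le_rpow_of_exponent_le (one_le_pow₀ one_le_two) ?_
          push_cast; linarith
      _ = 2 ^ ((m + 1) * j) := by rw [Real.rpow_natCast, ← pow_mul, mul_comm]
  have h1 : |diffQuotient p v (w + y, y)| ≤ 2 ^ ((m + 1) * j + K₀ + 1) := by
    simp only [diffQuotient, add_sub_cancel_right]
    rw [abs_div, abs_of_nonneg (Real.rpow_nonneg (norm_nonneg w) _), ← hγ]
    calc |v (w + y) - v y| / ‖w‖ ^ γ ≤ M / (ρ / (2 ^ j : ℕ) / 2) ^ γ := by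
          gcongr
          · exact hM _ _
          · exact hw.1.le
      _ = M * (2 / ρ) ^ γ * ((2 : ℝ) ^ j) ^ γ := by
          rw [div_eq_mul_inv, ← Real.inv_rpow hpos.le, mul_assoc,
            ← Real.mul_rpow (by positivity) (by positivity)]
          congr 2
          push_cast
          field_simp
      _ ≤ 2 ^ K₀ * 2 ^ ((m + 1) * j) := by gcongr
      _ ≤ 2 ^ ((m + 1) * j + K₀ + 1) := by
          rw [← pow_add]
          exact pow_le_pow_right₀ one_le_two (by omega)
  rw [← ofReal_norm, Real.norm_eq_abs]
  refine (ENNReal.ofReal_le_ofReal h1).trans (le_of_eq ?_)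
  rw [ENNReal.ofReal_pow (by norm_num)]
  simp

/-- A bounded function whose difference quotient is `o(1)` in the weak `L^p` sense
at large heights is almost everywhere constant. -/
theorem ae_const_of_tendsto_dyadic {N : ℕ} {p : ℝ} (hp : 1 ≤ p)
    {v : EuclideanSpace ℝ (Fin N) → ℝ} (hv : Measurable v) {M : ℝ}
    (hM : ∀ x y, |v x - v y| ≤ M)
    (ha : Tendsto (fun k : ℕ => (2 ^ (k + 1)) ^ p *
      volume {z | 2 ^ (k + 1) ≤ ‖diffQuotient p v z‖ₑ}) atTop (𝓝 0))
    (ha' : ∀ k : ℕ, (2 ^ (k + 1)) ^ p *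
      volume {z | 2 ^ (k + 1) ≤ ‖diffQuotient p v z‖ₑ} ≠ ∞) :
    ∃ c : ℝ, ∀ᵐ x, v x = c := by
  have hp0 : 0 < p := by linarith
  let E := EuclideanSpace ℝ (Fin N)
  -- The shear to `(x - y, y)` turns distance from the diagonal into the norm of the first
  -- coordinate.
  have hψ : MeasurePreserving (fun z : E × E => (z.1 - z.2, z.2)) volume volume :=
    measurePreserving_sub_prod (volume : Measure E) (volume : Measure E)
  set G : E × E → ℝ≥0∞ := fun z => ‖diffQuotient p v (z.1 + z.2, z.2)‖ₑ with hG_def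
  have hG : Measurable G :=
    ((measurable_diffQuotient hv).comp (measurable_add.prodMk measurable_snd)).enorm
  have hlevel : ∀ t : ℝ≥0∞, volume {z | t ≤ G z} = volume {z | t ≤ ‖diffQuotient p v z‖ₑ} := by
    intro t
    rw [← hψ.measure_preimage (measurableSet_le measurable_const hG).nullMeasurableSet]
    refine congrArg volume (Set.ext fun z => ?_)
    simp [hG_def, E]
  simp only [← hlevel] at ha ha'
  have hshell : ∀ (s : ℤ) (r : ℕ), ∀ᵐ z : E × E, z.1 ∈ dyadicShell E ((2 : ℝ) ^ s) →
      z.2 ∈ ball (0 : E) r → v (z.1 + z.2) = v z.2 := by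
    intro s r
    set ρ : ℝ := (2 : ℝ) ^ s
    have hρ : 0 < ρ := by positivity
    obtain ⟨m, K₀, hm, hb⟩ := exists_enorm_diffQuotient_le_two_pow hp hM hρ
    have hρN : ENNReal.ofReal (ρ ^ ((N : ℝ) + p)) ≠ 0 := by
      rw [Ne, ENNReal.ofReal_eq_zero, not_le]; positivity
    have hFm : Measurable fun z : E × E => ‖v (z.1 + z.2) - v z.2‖ₑ ^ p := by fun_prop
    have hzero : (ENNReal.ofReal (ρ ^ ((N : ℝ) + p)))⁻¹ *
        ∫⁻ h in dyadicShell E ρ, ∫⁻ y in ball 0 r, ‖v (h + y) - v y‖ₑ ^ p = 0 := by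
      refine eq_zero_of_le_setLIntegral_rpow (ν := (volume : Measure (E × E))) hG hp0.le
        (S := fun j => dyadicShell E (ρ / (2 ^ j : ℕ)) ×ˢ ball (0 : E) (r + ρ))
        (fun j => (measurableSet_dyadicShell _).prod measurableSet_ball) ?_ ?_ hm
        (fun j z hz => hb j z.1 hz.1 z.2) ha ha' fun j => ?_
      · intro i j hij
        exact Set.Disjoint.set_prod_left (pairwise_disjoint_dyadicShell E hρ hij) _ _
      · have hsub : (⋃ j : ℕ, dyadicShell E (ρ / (2 ^ j : ℕ)) ×ˢ ball (0 : E) (r + ρ)) ⊆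
            closedBall 0 ρ ×ˢ ball 0 (r + ρ) := by
          refine iUnion_subset fun j => prod_mono_left fun h hh => ?_
          rw [mem_closedBall_zero_iff]
          refine hh.2.trans (div_le_self hρ.le ?_)
          exact_mod_cast Nat.one_le_two_pow
        refine ((measure_mono hsub).trans_lt ?_).ne
        rw [Measure.volume_eq_prod, Measure.prod_prod]
        exact ENNReal.mul_lt_top measure_closedBall_lt_top measure_ball_lt_top
      · rw [Measure.volume_eq_prod, setLIntegral_prod _ (by fun_prop), mul_comm,
          ← div_eq_mul_inv]
        refine ENNReal.div_le_of_le_mul' ?_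
        exact setLIntegral_dyadicShell_le hp hv (by positivity) hρ r
    have hzero' := (mul_eq_zero.1 hzero).resolve_left (by simp)
    rw [← setLIntegral_prod (fun z : E × E => ‖v (z.1 + z.2) - v z.2‖ₑ ^ p) (by fun_prop),
      lintegral_eq_zero_iff hFm, Filter.EventuallyEq,
      ae_restrict_iff' ((measurableSet_dyadicShell _).prod measurableSet_ball)] at hzero'
    filter_upwards [hzero'] with z hz h1 h2
    have h3 := hz ⟨h1, h2⟩
    simp only [Pi.zero_apply, ENNReal.rpow_eq_zero_iff_of_pos hp0, enorm_eq_zero] at h3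
    linarith
  have hall : ∀ᵐ z : E × E, v (z.1 + z.2) = v z.2 := by
    have h := ae_all_iff.2 fun s : ℤ => ae_all_iff.2 fun r : ℕ => hshell s r
    filter_upwards [h] with z hz
    rcases eq_or_ne z.1 0 with h0 | h0
    · simp [h0]
    -- Shells are indexed by their outer radius, hence `n + 1`.
    · obtain ⟨n, hn1, hn2⟩ := exists_mem_Ioc_zpow (norm_pos_iff.2 h0) (one_lt_two : (1 : ℝ) < 2)
      obtain ⟨r, hr⟩ := exists_nat_gt ‖z.2‖
      refine hz (n + 1) r ⟨?_, hn2⟩ (by simpa using hr)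
      rwa [zpow_add_one₀ two_ne_zero, mul_div_cancel_right₀ _ two_ne_zero]
  have hxy : ∀ᵐ z : E × E, v z.1 = v z.2 := by
    filter_upwards [hψ.quasiMeasurePreserving.ae hall] with z hz
    simpa using hz
  rw [Measure.volume_eq_prod] at hxy
  obtain ⟨x, hx⟩ := (Measure.ae_ae_of_ae_prod hxy).exists
  exact ⟨v x, hx.mono fun y hy => hy.symm⟩

/-! ### Truncation by `arctan` -/

theorem Real.abs_arctan_sub_arctan_le (x y : ℝ) : |Real.arctan x - Real.arctan y| ≤ |x - y| := by
  have h := Convex.norm_image_sub_le_of_norm_hasDerivWithin_le (f := Real.arctan)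
    (f' := fun x => 1 / (1 + x ^ 2)) (C := 1) (s := univ) (x := y) (y := x)
    (fun x _ => (Real.hasDerivAt_arctan x).hasDerivWithinAt) ?_ convex_univ (mem_univ _)
    (mem_univ _)
  · simpa using h
  · intro x _
    rw [Real.norm_eq_abs, abs_of_nonneg (by positivity)]
    exact div_le_one_of_le₀ (by nlinarith [sq_nonneg x]) (by positivity)

theorem Real.abs_arctan_sub_arctan_le_pi (x y : ℝ) :
    |Real.arctan x - Real.arctan y| ≤ Real.pi := by
  rw [abs_le]
  constructor <;> linarith [Real.arctan_lt_pi_div_two x, Real.arctan_lt_pi_div_two y,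
    Real.neg_pi_div_two_lt_arctan x, Real.neg_pi_div_two_lt_arctan y]

/-! ### From the Lorentz quasinorm to dyadic levels -/

theorem lorentzQuasinorm_mono_ae {α : Type*} [MeasurableSpace α] {μ : Measure α} {f g : α → ℝ}
    {p q : ℝ} (hp : 0 ≤ p) (hq : 0 ≤ q) (h : ∀ᵐ z ∂μ, |f z| ≤ |g z|) :
    lorentzQuasinorm f p q μ ≤ lorentzQuasinorm g p q μ := by
  have hle : ∀ t : ℝ, μ {z | t ≤ |f z|} ≤ μ {z | t ≤ |g z|} := fun t => by
    refine measure_mono_ae ?_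
    filter_upwards [h] with z hz ht
    exact le_trans (show t ≤ |f z| from ht) hz
  unfold lorentzQuasinorm
  exact ENNReal.rpow_le_rpow (mul_le_mul_right (lintegral_mono fun t => ENNReal.div_le_div_right
    (mul_le_mul_right (ENNReal.rpow_le_rpow (hle t) (by positivity)) _) _) _) (by positivity)

/-- Finiteness of the Lorentz quasinorm for a finite second exponent forces the dyadic
weak `L^p` quantities to be finite and to tend to zero. -/
theorem dyadic_of_lorentzQuasinorm_lt_top {α : Type*} [MeasurableSpace α] {μ : Measure α}
    {f : α → ℝ} {p q : ℝ} (hp : 0 < p) (hq : 1 ≤ q) (h : lorentzQuasinorm f p q μ < ∞) :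
    Tendsto (fun k : ℕ => (2 ^ (k + 1)) ^ p * μ {z | 2 ^ (k + 1) ≤ ‖f z‖ₑ}) atTop (𝓝 0) ∧
    ∀ k : ℕ, (2 ^ (k + 1)) ^ p * μ {z | 2 ^ (k + 1) ≤ ‖f z‖ₑ} ≠ ∞ := by
  have hq0 : 0 < q := by linarith
  set a : ℕ → ℝ≥0∞ := fun k => (2 ^ (k + 1)) ^ p * μ {z | 2 ^ (k + 1) ≤ ‖f z‖ₑ} with ha
  set g : ℝ → ℝ≥0∞ := fun t =>
    ENNReal.ofReal t ^ q * μ {z | t ≤ |f z|} ^ (q / p) / ENNReal.ofReal t with hg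
  have hI : ∫⁻ t in Ioi (0 : ℝ), g t ≠ ∞ := by
    rw [lorentzQuasinorm, ENNReal.rpow_lt_top_iff_of_pos (by positivity)] at h
    exact (ENNReal.lt_top_of_mul_ne_top_right h.ne (by simpa using hp)).ne
  set I : ℕ → Set ℝ := fun k => Ioc ((2 : ℝ) ^ k) (2 ^ (k + 1)) with hI_def
  have hdisj : Pairwise (Function.onFun Disjoint I) := by
    have := (pow_right_mono₀ (one_le_two : (1 : ℝ) ≤ 2)).pairwise_disjoint_on_Ioc_succ
    exact this
  have hsub : (⋃ k, I k) ⊆ Ioi 0 :=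
    iUnion_subset fun k t ht => lt_trans (by positivity : (0 : ℝ) < 2 ^ k) ht.1
  have hlow : ∀ k, (2 ^ q)⁻¹ * a k ^ (q / p) ≤ ∫⁻ t in I k, g t := by
    intro k
    have hlev : {z | 2 ^ (k + 1) ≤ ‖f z‖ₑ} = {z | (2 : ℝ) ^ (k + 1) ≤ |f z|} := by
      ext z
      have h2 : (2 : ℝ≥0∞) ^ (k + 1) = ENNReal.ofReal (2 ^ (k + 1)) := by
        rw [ENNReal.ofReal_pow (by norm_num)]; simp
      rw [mem_ofPred_eq, mem_ofPred_eq, ← ofReal_norm, Real.norm_eq_abs, h2, ENNReal.ofReal_le_ofReal_iff (abs_nonneg _)]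
    have hpow : ∀ j : ℕ, ENNReal.ofReal (2 ^ j) = 2 ^ j := fun j => by
      rw [ENNReal.ofReal_pow (by norm_num)]; simp
    have hvol : volume (I k) = 2 ^ k := by
      rw [hI_def, Real.volume_Ioc, ← hpow k]
      congr 1; ring
    -- A lower bound for the integrand on `I k`: the power of `t` is taken at the left end (as `q ≥
    -- 1`), the decreasing level measure at the right end.
    set c : ℝ≥0∞ := (2 ^ k) ^ (q - 1) * μ {z | (2 : ℝ) ^ (k + 1) ≤ |f z|} ^ (q / p)
    calc (2 ^ q)⁻¹ * a k ^ (q / p) = c * volume (I k) := by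
          have hk0 : (2 : ℝ≥0∞) ^ k ≠ 0 := by simp
          have hkt : (2 : ℝ≥0∞) ^ k ≠ ∞ := by simp
          simp only [ha, hlev, c, hvol]
          rw [ENNReal.mul_rpow_of_nonneg _ _ (by positivity), ← ENNReal.rpow_mul,
            mul_div_cancel₀ _ hp.ne', pow_succ', ENNReal.mul_rpow_of_nonneg _ _ hq0.le,
            ← mul_assoc, ← mul_assoc, ENNReal.inv_mul_cancel, one_mul, mul_right_comm]
          · congr 1
            nth_rw 3 [← ENNReal.rpow_one ((2 : ℝ≥0∞) ^ k)]
            rw [← ENNReal.rpow_add _ _ hk0 hkt, sub_add_cancel]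
          · simp
          · exact ENNReal.rpow_ne_top_of_nonneg hq0.le (by simp)
      _ = ∫⁻ t in I k, c := by simp
      _ ≤ ∫⁻ t in I k, g t := by
          refine setLIntegral_mono' measurableSet_Ioc fun t ht => ?_
          have ht0 : 0 < t := lt_trans (by positivity : (0 : ℝ) < 2 ^ k) ht.1
          have h0 : ENNReal.ofReal t ≠ 0 := by simpa using ht0
          have hgt : g t = ENNReal.ofReal t ^ (q - 1) * μ {z | t ≤ |f z|} ^ (q / p) := by
            rw [hg, ENNReal.rpow_sub _ _ h0 ENNReal.ofReal_ne_top, ENNReal.rpow_one]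
            simp only [div_eq_mul_inv]
            ring
          rw [hgt]
          refine mul_le_mul' (ENNReal.rpow_le_rpow ?_ (by linarith))
            (ENNReal.rpow_le_rpow (measure_mono ?_) (by positivity))
          · rw [← hpow]
            exact ENNReal.ofReal_le_ofReal ht.1.le
          · exact fun z hz => le_trans ht.2 hz
  have hsum : ∑' k, (2 ^ q)⁻¹ * a k ^ (q / p) ≠ ∞ := by
    refine ne_top_of_le_ne_top hI ?_
    calc ∑' k, (2 ^ q)⁻¹ * a k ^ (q / p) ≤ ∑' k, ∫⁻ t in I k, g t := ENNReal.tsum_le_tsum hlow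
      _ = ∫⁻ t in ⋃ k, I k, g t := (lintegral_iUnion (fun _ => measurableSet_Ioc) hdisj _).symm
      _ ≤ ∫⁻ t in Ioi 0, g t := lintegral_mono_set hsub
  rw [ENNReal.tsum_mul_left] at hsum
  have hsum' : ∑' k, a k ^ (q / p) ≠ ∞ := by
    refine (ENNReal.lt_top_of_mul_ne_top_right hsum ?_).ne
    exact ENNReal.inv_ne_zero.2 (ENNReal.rpow_ne_top_of_nonneg hq0.le (by simp))
  have hinv : ∀ k, (a k ^ (q / p)) ^ (p / q) = a k := fun k => by
    rw [← ENNReal.rpow_mul, div_mul_div_cancel₀ hp.ne', div_self hq0.ne', ENNReal.rpow_one]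
  constructor
  · have h0 := ENNReal.tendsto_atTop_zero_of_tsum_ne_top hsum'
    have h1 := h0.ennrpow_const (p / q)
    simpa only [hinv, ENNReal.zero_rpow_of_pos (div_pos hp hq0)] using h1
  · intro k
    have := ENNReal.ne_top_of_tsum_ne_top hsum' k
    show a k ≠ ∞
    rw [← hinv k]
    exact ENNReal.rpow_ne_top_of_nonneg (by positivity) this

/-! ### Constancy and failure of the gradient bound -/

theorem abs_diffQuotient_le_of_abs_sub_le {N : ℕ} {p : ℝ} {u v : EuclideanSpace ℝ (Fin N) → ℝ}
    {z : EuclideanSpace ℝ (Fin N) × EuclideanSpace ℝ (Fin N)}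
    (h : |u z.1 - u z.2| ≤ |v z.1 - v z.2|) :
    |diffQuotient p u z| ≤ |diffQuotient p v z| := by
  simp only [diffQuotient, abs_div]
  gcongr

theorem ae_const_of_lorentzQuasinorm_diffQuotient_lt_top {N : ℕ} {p q : ℝ} (hp : 1 ≤ p)
    (hq : 1 ≤ q) {u : EuclideanSpace ℝ (Fin N) → ℝ} (hu : AEMeasurable u volume)
    (h : lorentzQuasinorm (diffQuotient p u) p q volume < ∞) : ∃ c : ℝ, ∀ᵐ x, u x = c := by
  set w := hu.mk u
  have hw : Measurable w := hu.measurable_mk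
  have hae : ∀ᵐ x ∂volume, u x = w x := hu.ae_eq_mk
  have hle : lorentzQuasinorm (diffQuotient p fun x => Real.arctan (w x)) p q volume < ∞ := by
    refine (lorentzQuasinorm_mono_ae (by linarith) (by linarith) ?_).trans_lt h
    let μ : Measure (EuclideanSpace ℝ (Fin N)) := volume
    have h1 := (Measure.quasiMeasurePreserving_fst (μ := μ) (ν := μ)).ae hae
    have h2 := (Measure.quasiMeasurePreserving_snd (μ := μ) (ν := μ)).ae hae
    rw [Measure.volume_eq_prod]
    filter_upwards [h1, h2] with z hz1 hz2
    refine abs_diffQuotient_le_of_abs_sub_le ?_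
    rw [hz1, hz2]
    exact Real.abs_arctan_sub_arctan_le _ _
  obtain ⟨ha, ha'⟩ := dyadic_of_lorentzQuasinorm_lt_top (by linarith) hq hle
  obtain ⟨c, hc⟩ := ae_const_of_tendsto_dyadic hp (Real.measurable_arctan.comp hw)
    (fun _ _ => Real.abs_arctan_sub_arctan_le_pi _ _) ha ha'
  obtain ⟨x₀, hx₀⟩ := hc.exists
  refine ⟨w x₀, ?_⟩
  filter_upwards [hae, hc] with x h1 h2
  rw [h1]
  exact Real.arctan_injective (h2.trans hx₀.symm)

theorem eLpNorm_gradient_lt_top {E : Type*} [NormedAddCommGroup E] [InnerProductSpace ℝ E]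
    [CompleteSpace E] [MeasurableSpace E] [BorelSpace E] [SecondCountableTopology E]
    {μ : Measure E} [IsFiniteMeasureOnCompacts μ]
    {u : E → ℝ} (hu : ContDiff ℝ 1 u) (hc : HasCompactSupport u) (p : ℝ≥0∞) :
    eLpNorm (gradient u) p μ < ∞ := by
  have hcont : Continuous (gradient u) :=
    (InnerProductSpace.toDual ℝ E).symm.continuous.comp (hu.continuous_fderiv one_ne_zero)
  have hsupp : HasCompactSupport (gradient u) :=
    (hc.fderiv (𝕜 := ℝ)).comp_left (map_zero (InnerProductSpace.toDual ℝ E).symm)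
  exact (hcont.memLp_of_hasCompactSupport hsupp).2

theorem theorem1 (N : ℕ) (hN : 1 ≤ N) (p q : ℝ) (hp : 1 ≤ p) (hq : 1 ≤ q) :
    (∀ u : EuclideanSpace ℝ (Fin N) → ℝ, AEMeasurable u volume →
      lorentzQuasinorm (diffQuotient p u) p q volume < ∞ →
      ∃ c : ℝ, ∀ᵐ x ∂(volume : Measure (EuclideanSpace ℝ (Fin N))), u x = c) ∧
    ¬ ∃ C : ℝ≥0, ∀ u : EuclideanSpace ℝ (Fin N) → ℝ,
      ContDiff ℝ (⊤ : ℕ∞) u → HasCompactSupport u →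
      lorentzQuasinorm (diffQuotient p u) p q volume ≤
        (C : ℝ≥0∞) * eLpNorm (gradient u) (ENNReal.ofReal p) volume := by
  refine ⟨fun u hu h => ae_const_of_lorentzQuasinorm_diffQuotient_lt_top hp hq hu h, ?_⟩
  rintro ⟨C, hC⟩
  -- Dimension at least one supplies a point of norm above 2, where the bump vanishes.
  have : Nonempty (Fin N) := ⟨⟨0, hN⟩⟩
  set φ : ContDiffBump (0 : EuclideanSpace ℝ (Fin N)) := ⟨1, 2, one_pos, one_lt_two⟩
  have hφ : ContDiff ℝ (⊤ : ℕ∞) φ := φ.contDiff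
  have hlt : lorentzQuasinorm (diffQuotient p φ) p q volume < ∞ :=
    (hC φ hφ φ.hasCompactSupport).trans_lt (ENNReal.mul_lt_top ENNReal.coe_lt_top
      (eLpNorm_gradient_lt_top (hφ.of_le (by exact_mod_cast le_top)) φ.hasCompactSupport _))
  obtain ⟨c, hc⟩ := ae_const_of_lorentzQuasinorm_diffQuotient_lt_top hp hq
    φ.continuous.aemeasurable hlt
  have heq : (φ : EuclideanSpace ℝ (Fin N) → ℝ) = fun _ => c :=
    Measure.eq_of_ae_eq hc φ.continuous continuous_const
  obtain ⟨x, hx⟩ := (NormedSpace.exists_lt_norm ℝ (EuclideanSpace ℝ (Fin N)) 2)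
  have h0 : φ 0 = 1 := φ.one_of_mem_closedBall (by simp [φ])
  have hx0 : φ x = 0 := φ.zero_of_le_dist (by simpa [φ] using hx.le)
  rw [heq] at h0 hx0
  exact one_ne_zero (h0.symm.trans hx0)
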